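/- **Setting.** Vanilla quantum circuits are the morphisms of the prop freely generated by $H:1\to1$, $P(\varphi):1\to1$, $\mathrm{CNOT}:2\to2$ (control on the first wire) and the global phase $s(\varphi):0\to0$, for $\varphi\in\mathbb R$; $I$ denotes the identity on one wire and $\mathrm{SWAP}:2\to2$ the symmetry of the prop. For an equational theory $\Gamma$ (a set of equations between circuits), $\Gamma\vdash C_1=C_2$ means that $C_1$ can be transformed into $C_2$ using the equations of $\Gamma$ and the deformation rules of the prop (associativity of $\circ$ and $\otimes$, interchange law, units, $\mathrm{SWAP}\circ\mathrm{SWAP}=I\otimes I$, naturality of the symmetry). Put $R_X(\theta)=s(-\theta/2)\otimes(H\circ P(\theta)\circ H)$, $\mathrm{NOTC}=\mathrm{SWAP}\circ\mathrm{CNOT}\circ\mathrm{SWAP}$, and define the phase gate with $n$ controls $\Lambda^nP(\varphi):n+1\to n+1$ inductively by $\Lambda^0P(\varphi)=P(\varphi)$ and, with $K=I^{\otimes n}\otimes\mathrm{CNOT}$, $S=I^{\otimes n}\otimes\mathrm{SWAP}$ and $\Lambda'(\psi)=S\circ(\Lambda^nP(\psi)\otimes I)\circ S$, $$\Lambda^{n+1}P(\varphi)=K\circ\Lambda'(-\tfrac\varphi2)\circ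 K\circ\Lambda'(\tfrac\varphi2)\circ(\Lambda^nP(\tfrac\varphi2)\otimes I).$$ The equational theory $\mathrm{QC}'$ has the following axioms, for all $\varphi,\varphi_1,\varphi_2,\alpha_1',\alpha_3'\in\mathbb R$ and all $n\ge3$: * $(S_{2\pi})$ $s(2\pi)=$ the empty circuit; $(S_+)$ $s(\varphi_1)\otimes s(\varphi_2)=s(\varphi_1+\varphi_2)$; * $(H^2)$ $H\circ H=I$; $(P_0)$ $P(0)=I$; $(P_+)$ $P(\varphi_2)\circ P(\varphi_1)=P(\varphi_1+\varphi_2)$; * $(C)$ $\mathrm{CNOT}\circ(P(\varphi)\otimes I)\circ\mathrm{CNOT}=P(\varphi)\otimes I$; $(B)$ $\mathrm{NOTC}\circ\mathrm{CNOT}=\mathrm{CNOT}\circ\mathrm{SWAP}$; * $(CZ)$ $(I\otimes H)\circ\mathrm{CNOT}\circ(I\otimes H)=\mathrm{CNOT}\circ(I\otimes P(-\tfrac\pi2))\circ\mathrm{CNOT}\circ(P(\tfrac\pi2)\otimes P(\tfrac\pi2))$; * $(E')$ $R_X(\alpha_3')\circ H\circ R_X(\alpha_1')=s(\beta_0')\otimes\bigl(P(\beta_3')\circ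 R_X(\beta_2')\circ P(\beta_1')\bigr)$, where $z=-\sin\frac{\alpha_1'+\alpha_3'}2+i\cos\frac{\alpha_1'-\alpha_3'}2$, $z'=\cos\frac{\alpha_1'+\alpha_3'}2-i\sin\frac{\alpha_1'-\alpha_3'}2$ and, modulo $2\pi$ in $[0,2\pi)$: if $z'=0$, $(\beta_0',\beta_1',\beta_2',\beta_3')=(\frac\pi2-\arg z,\,2\arg z,\,0,\,0)$; if $z=0$, $(\frac\pi2-\arg z',\,2\arg z',\,\pi,\,0)$; otherwise $\bigl(\frac\pi2-\arg z,\ \arg z+\arg z',\ 2\arg(i+|z/z'|),\ \arg z-\arg z'\bigr)$; * $(I_n)$ $\Lambda^{n-1}P(2\pi)=I^{\otimes n}$ (one axiom for each $n\ge3$). **Theorem (Minimality).** The theory $\mathrm{QC}'$ is minimal: none of its axioms is derivable from the others. That is, for each of the axioms $(S_{2\pi})$, $(S_+)$, $(H^2)$, $(P_0)$, $(C)$, $(B)$, $(CZ)$, $(P_+)$, $(E')$ and each axiom $(I_n)$ with $n\ge3$, some instance of that axiom cannot be derived from all instances of all the other axioms (for $(I_n)$ these include $(I_m)$ for every $m\ge3$,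 $m\ne n$). Moreover, uncountably many instances of $(E')$ are needed: for every set $T\subseteq\mathbb R^2$ of cardinality strictly less than $2^{\aleph_0}$, there are $\alpha_1',\alpha_3'\in\mathbb R$ such that the instance of $(E')$ with parameters $(\alpha_1',\alpha_3')$ cannot be derived from the instances of $(E')$ with parameters in $T$ together with all instances of all the other axioms of $\mathrm{QC}'$. -/

import Mathlib

namespace QCirc

noncomputable section

/-- Terms for vanilla quantum circuits with `n` input and `m` output wires, built from the
generators `H`, `P φ`, `CNOT` (control on the first wire, target on the second), the global phase
`s φ`, and the structural circuits of a prop. The prop of circuits is the quotient of these terms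
by the deformation rules, which are part of derivability (`Deriv`). -/
inductive Circ : ℕ → ℕ → Type
  | empty : Circ 0 0
  | wire : Circ 1 1
  | swap : Circ 2 2
  | H : Circ 1 1
  | P (φ : ℝ) : Circ 1 1
  | CNOT : Circ 2 2
  | s (φ : ℝ) : Circ 0 0
  | seq {n m p : ℕ} (a : Circ n m) (b : Circ m p) : Circ n p
  | par {n m n' m' : ℕ} (a : Circ n m) (b : Circ n' m') : Circ (n + n') (m + m')

/-- Sequential composition in diagrammatic order: `a ⨟ b` is `b ∘ a`. -/
infixl:60 " ⨟ " => Circ.seq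

/-- Parallel composition. -/
infixl:70 " ⊠ " => Circ.par

namespace Circ

/-- Transport of a circuit along equalities of its numbers of wires. -/
def cast {n m n' m' : ℕ} (hn : n = n') (hm : m = m') (a : Circ n m) : Circ n' m' :=
  hn ▸ hm ▸ a

/-- The identity on `n` wires. -/
def wires : (n : ℕ) → Circ n n
  | 0 => empty
  | n + 1 => wires n ⊠ wire

/-- The circuit `a` with one more wire below. -/
def addWire {n m : ℕ} (a : Circ n m) : Circ (n + 1) (m + 1) := a ⊠ wire

/-- The circuit on `n + 2` wires that applies `a` to the last two wires. -/
def onLastTwo (n : ℕ) (a : Circ 2 2) : Circ (n + 2) (n + 2) := wires n ⊠ a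

/-- The circuit on `n + 1` wires that moves the last wire above the `n` other ones. -/
def sigma : (n : ℕ) → Circ (n + 1) (n + 1)
  | 0 => wire
  | n + 1 => onLastTwo n swap ⨟ addWire (sigma n)

/-- The `X`-rotation `R_X(θ)`. -/
def RX (θ : ℝ) : Circ 1 1 := s (-θ / 2) ⊠ (H ⨟ P θ ⨟ H)

/-- The CNot gate with control on the second wire and target on the first one. -/
def NOTC : Circ 2 2 := swap ⨟ CNOT ⨟ swap

/-- For a circuit `a` on `n + 1` wires, the circuit on `n + 2` wires that applies `a` to the first
`n` wires and to the last one. -/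
def skip (n : ℕ) (a : Circ (n + 1) (n + 1)) : Circ (n + 2) (n + 2) :=
  onLastTwo n swap ⨟ addWire a ⨟ onLastTwo n swap

/-- The phase gate `P(φ)` on the last of `n + 1` wires, controlled by the first `n` wires. -/
def mctrlP : (n : ℕ) → ℝ → Circ (n + 1) (n + 1)
  | 0, φ => P φ
  | n + 1, φ =>
      addWire (mctrlP n (φ / 2)) ⨟ skip n (mctrlP n (φ / 2)) ⨟
        onLastTwo n CNOT ⨟ skip n (mctrlP n (-φ / 2)) ⨟ onLastTwo n CNOT

end Circ

open Circ

/-- An equational theory: a collection of equations between circuits of the same type. -/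
def Theory : Type := ∀ ⦃n m : ℕ⦄, Circ n m → Circ n m → Prop

/-- `Deriv Γ a b` is `Γ ⊢ a = b`: the circuit `a` can be transformed into `b` using the equations
of `Γ` and the deformation rules of props. -/
inductive Deriv (Γ : Theory) : ∀ {n m : ℕ}, Circ n m → Circ n m → Prop
  | ax {n m : ℕ} {a b : Circ n m} : Γ a b → Deriv Γ a b
  | refl {n m : ℕ} (a : Circ n m) : Deriv Γ a a
  | symm {n m : ℕ} {a b : Circ n m} : Deriv Γ a b → Deriv Γ b a
  | trans {n m : ℕ} {a b c : Circ n m} : Deriv Γ a b → Deriv Γ b c → Deriv Γ a c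
  | seq_congr {n m p : ℕ} {a a' : Circ n m} {b b' : Circ m p} :
      Deriv Γ a a' → Deriv Γ b b' → Deriv Γ (a ⨟ b) (a' ⨟ b')
  | par_congr {n m n' m' : ℕ} {a a' : Circ n m} {b b' : Circ n' m'} :
      Deriv Γ a a' → Deriv Γ b b' → Deriv Γ (a ⊠ b) (a' ⊠ b')
  | seq_assoc {n m p q : ℕ} (a : Circ n m) (b : Circ m p) (c : Circ p q) :
      Deriv Γ (a ⨟ b ⨟ c) (a ⨟ (b ⨟ c))
  | par_assoc {n₁ m₁ n₂ m₂ n₃ m₃ : ℕ} (a : Circ n₁ m₁) (b : Circ n₂ m₂) (c : Circ n₃ m₃) :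
      Deriv Γ (Circ.cast (Nat.add_assoc n₁ n₂ n₃) (Nat.add_assoc m₁ m₂ m₃) (a ⊠ b ⊠ c))
        (a ⊠ (b ⊠ c))
  | interchange {n m p n' m' p' : ℕ} (a : Circ n m) (b : Circ n' m') (c : Circ m p)
      (d : Circ m' p') :
      Deriv Γ (a ⊠ b ⨟ c ⊠ d) ((a ⨟ c) ⊠ (b ⨟ d))
  | par_empty {n m : ℕ} (a : Circ n m) : Deriv Γ (a ⊠ empty) a
  | empty_par {n m : ℕ} (a : Circ n m) :
      Deriv Γ (Circ.cast (Nat.zero_add n) (Nat.zero_add m) (empty ⊠ a)) a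
  | wires_seq {n m : ℕ} (a : Circ n m) : Deriv Γ (wires n ⨟ a) a
  | seq_wires {n m : ℕ} (a : Circ n m) : Deriv Γ (a ⨟ wires m) a
  | swap_swap : Deriv Γ (swap ⨟ swap) (wire ⊠ wire)
  | sigma_natural {n m : ℕ} (a : Circ n m) :
      Deriv Γ (addWire a ⨟ sigma m)
        (sigma n ⨟ Circ.cast (Nat.add_comm 1 n) (Nat.add_comm 1 m) (wire ⊠ a))

/-- Minimality of the equational theory whose axioms are the equations `R i`, each of which may be
a schema, that is, a family of instances: no axiom `R i` is derivable from the other axioms. -/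
def IsMinimal {ι : Type} (R : ι → Theory) : Prop :=
  ∀ i : ι, ∃ (n m : ℕ) (a b : Circ n m), R i a b ∧
    ¬ Deriv (fun _ _ c d => ∃ j : ι, j ≠ i ∧ R j c d) a b

/-! ### Angles of the Euler rule with two parameters -/

/-- Reduction of an angle modulo `2π` to `[0, 2π)`. -/
def mod2pi (x : ℝ) : ℝ := toIcoMod Real.two_pi_pos 0 x

def eulerZ (α₁ α₃ : ℝ) : ℂ := ⟨-Real.sin ((α₁ + α₃) / 2), Real.cos ((α₁ - α₃) / 2)⟩

def eulerZ' (α₁ α₃ : ℝ) : ℂ := ⟨Real.cos ((α₁ + α₃) / 2), -Real.sin ((α₁ - α₃) / 2)⟩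

open Classical in
def beta0 (α₁ α₃ : ℝ) : ℝ :=
  if eulerZ' α₁ α₃ = 0 then mod2pi (Real.pi / 2 - (eulerZ α₁ α₃).arg)
  else if eulerZ α₁ α₃ = 0 then mod2pi (Real.pi / 2 - (eulerZ' α₁ α₃).arg)
  else mod2pi (Real.pi / 2 - (eulerZ α₁ α₃).arg)

open Classical in
def beta1 (α₁ α₃ : ℝ) : ℝ :=
  if eulerZ' α₁ α₃ = 0 then mod2pi (2 * (eulerZ α₁ α₃).arg)
  else if eulerZ α₁ α₃ = 0 then mod2pi (2 * (eulerZ' α₁ α₃).arg)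
  else mod2pi ((eulerZ α₁ α₃).arg + (eulerZ' α₁ α₃).arg)

open Classical in
def beta2 (α₁ α₃ : ℝ) : ℝ :=
  if eulerZ' α₁ α₃ = 0 then 0
  else if eulerZ α₁ α₃ = 0 then Real.pi
  else mod2pi (2 * (Complex.I + (‖eulerZ α₁ α₃ / eulerZ' α₁ α₃‖ : ℂ)).arg)

open Classical in
def beta3 (α₁ α₃ : ℝ) : ℝ :=
  if eulerZ' α₁ α₃ = 0 then 0
  else if eulerZ α₁ α₃ = 0 then 0
  else mod2pi ((eulerZ α₁ α₃).arg - (eulerZ' α₁ α₃).arg)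

/-- Left-hand side of (E'). -/
def eulerLHS (α₁ α₃ : ℝ) : Circ 1 1 := RX α₁ ⨟ H ⨟ RX α₃

/-- Right-hand side of (E'). -/
def eulerRHS (α₁ α₃ : ℝ) : Circ 1 1 :=
  s (beta0 α₁ α₃) ⊠ (P (beta1 α₁ α₃) ⨟ RX (beta2 α₁ α₃) ⨟ P (beta3 α₁ α₃))

/-- Names of the axioms of `QC'`. The axiom (I) is one axiom for each number of qubits `≥ 3`:
`ctrl2pi k` is (I) on `k + 3` qubits. -/
inductive Axiom
  | s2pi | sAdd | hh | p0 | cnotPCnot | bigebre | cz | pAdd | eulerPrime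
  | ctrl2pi (k : ℕ)

/-- The equational theory `QC'`: `QCPrime l` is the collection of all instances of the axiom
named `l`. -/
inductive QCPrime : Axiom → ∀ ⦃n m : ℕ⦄, Circ n m → Circ n m → Prop
  | s2pi : QCPrime .s2pi (s (2 * Real.pi)) empty
  | sAdd (φ₁ φ₂ : ℝ) : QCPrime .sAdd (s φ₁ ⊠ s φ₂) (s (φ₁ + φ₂))
  | hh : QCPrime .hh (H ⨟ H) wire
  | p0 : QCPrime .p0 (P 0) wire
  | cnotPCnot (φ : ℝ) : QCPrime .cnotPCnot (CNOT ⨟ P φ ⊠ wire ⨟ CNOT) (P φ ⊠ wire)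
  | bigebre : QCPrime .bigebre (CNOT ⨟ NOTC) (swap ⨟ CNOT)
  | cz : QCPrime .cz (wire ⊠ H ⨟ CNOT ⨟ wire ⊠ H)
      (P (Real.pi / 2) ⊠ P (Real.pi / 2) ⨟ CNOT ⨟ wire ⊠ P (-Real.pi / 2) ⨟ CNOT)
  | pAdd (φ₁ φ₂ : ℝ) : QCPrime .pAdd (P φ₁ ⨟ P φ₂) (P (φ₁ + φ₂))
  | eulerPrime (α₁ α₃ : ℝ) : QCPrime .eulerPrime (eulerLHS α₁ α₃) (eulerRHS α₁ α₃)
  | ctrl2pi (k : ℕ) :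
      QCPrime (.ctrl2pi k) (mctrlP (k + 2) (2 * Real.pi)) (wires (k + 3))

/-- The theory `QC'` in which (E') is restricted to the instances with parameters
`(α₁, α₃) ∈ T`; all other axioms are kept with all their instances. -/
inductive QCPrimeRestrict (T : Set (ℝ × ℝ)) : ∀ ⦃n m : ℕ⦄, Circ n m → Circ n m → Prop
  | eulerPrime (α₁ α₃ : ℝ) : (α₁, α₃) ∈ T →
      QCPrimeRestrict T (eulerLHS α₁ α₃) (eulerRHS α₁ α₃)
  | other (l : Axiom) {n m : ℕ} (a b : Circ n m) : l ≠ .eulerPrime → QCPrime l a b →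
      QCPrimeRestrict T a b

end

end QCirc

namespace QCirc

open Circ

/-! Each independence is witnessed by a scalar invariant: generators are sent to a commutative
monoid and both compositions to multiplication. The deformation rules then hold as soon as the swap
squares to 1, so only axioms need checking. Circuits preserve the number of wires, so a derivation
on `n` wires never uses an axiom on more than `n` wires; `Deriv.eval_eq` makes this precise, and it
is what lets such crude invariants suffice.

For most axioms on at most two wires the invariant is a presence or parity test on generators. For
(P_+) it tests whether every phase angle is a multiple of `π / 2`; the work is to show that (E')
respects this (`euler_sin_two_mul_eq_zero_iff`). For (I_n) it is a square root of the determinant on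
`n` wires: -1 on the fully controlled `2π` phase, but 1 on those with fewer controls.

For (E') it is the sum of the phase-gate angles modulo a subgroup `V` of `ℝ` containing the defects
of the instances in `T`. As `V` has fewer than continuum many elements and the defect takes
continuum many values, some instance is not preserved. The case of empty `T` gives the independence
of (E') itself. -/

/-- An interpretation of the generators in a commutative monoid. Both compositions are sent to
multiplication and the identities to `1`. -/
structure Interp (M : Type) [CommMonoid M] where
  h : M
  p : ℝ → M
  c : M
  s : ℝ → M
  w : M
  w_mul_w : w * w = 1

/-! ### Evaluation of circuits and bounded-width soundness. -/

namespace Interp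

variable {M : Type} [CommMonoid M]

/-- The value of a circuit under an interpretation of the generators. -/
def eval (v : Interp M) : ∀ {n m : ℕ}, Circ n m → M
  | _, _, empty => 1
  | _, _, wire => 1
  | _, _, swap => v.w
  | _, _, Circ.H => v.h
  | _, _, Circ.P φ => v.p φ
  | _, _, CNOT => v.c
  | _, _, Circ.s φ => v.s φ
  | _, _, seq a b => v.eval a * v.eval b
  | _, _, par a b => v.eval a * v.eval b

@[simp] theorem eval_empty (v : Interp M) : v.eval empty = 1 := rfl
@[simp] theorem eval_wire (v : Interp M) : v.eval wire = 1 := rfl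
@[simp] theorem eval_swap (v : Interp M) : v.eval swap = v.w := rfl
@[simp] theorem eval_H (v : Interp M) : v.eval Circ.H = v.h := rfl
@[simp] theorem eval_P (v : Interp M) (φ : ℝ) : v.eval (Circ.P φ) = v.p φ := rfl
@[simp] theorem eval_CNOT (v : Interp M) : v.eval CNOT = v.c := rfl
@[simp] theorem eval_s (v : Interp M) (φ : ℝ) : v.eval (Circ.s φ) = v.s φ := rfl

@[simp] theorem eval_seq (v : Interp M) {n m q : ℕ} (a : Circ n m) (b : Circ m q) :
    v.eval (a ⨟ b) = v.eval a * v.eval b := rfl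

@[simp] theorem eval_par (v : Interp M) {n m n' m' : ℕ} (a : Circ n m) (b : Circ n' m') :
    v.eval (a ⊠ b) = v.eval a * v.eval b := rfl

@[simp] theorem eval_cast (v : Interp M) {n m n' m' : ℕ} (hn : n = n') (hm : m = m')
    (a : Circ n m) : v.eval (Circ.cast hn hm a) = v.eval a := by
  subst hn hm
  rfl

@[simp] theorem eval_wires (v : Interp M) (n : ℕ) : v.eval (wires n) = 1 := by
  induction n with
  | zero => rfl
  | succ n ih => simp [wires, ih]

@[simp] theorem eval_addWire (v : Interp M) {n m : ℕ} (a : Circ n m) :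
    v.eval (addWire a) = v.eval a := by
  simp [addWire]

@[simp] theorem eval_onLastTwo (v : Interp M) (n : ℕ) (a : Circ 2 2) :
    v.eval (onLastTwo n a) = v.eval a := by
  simp [onLastTwo]

@[simp] theorem eval_skip (v : Interp M) (n : ℕ) (a : Circ (n + 1) (n + 1)) :
    v.eval (skip n a) = v.eval a := by
  simp [skip, mul_right_comm, v.w_mul_w]

@[simp] theorem eval_NOTC (v : Interp M) : v.eval NOTC = v.c := by
  rw [NOTC, eval_seq, eval_seq, eval_swap, eval_CNOT, mul_right_comm, v.w_mul_w, one_mul]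

@[simp] theorem eval_RX (v : Interp M) (θ : ℝ) :
    v.eval (RX θ) = v.s (-θ / 2) * (v.h * v.p θ * v.h) := rfl

end Interp

theorem Circ.wires_eq {n m : ℕ} (a : Circ n m) : n = m := by
  induction a <;> omega

/-- Soundness on circuits with at most `k` wires: an interpretation which validates the equations
of `Γ` between such circuits validates all the consequences of `Γ` between such circuits. -/
theorem Deriv.eval_eq {M : Type} [CommMonoid M] {Γ : Theory} (v : Interp M) (k : ℕ)
    (hΓ : ∀ ⦃n m : ℕ⦄ (a b : Circ n m), Γ a b → n ≤ k → v.eval a = v.eval b)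
    {n m : ℕ} {a b : Circ n m} (h : Deriv Γ a b) : n ≤ k → v.eval a = v.eval b := by
  induction h with
  | ax h => exact hΓ _ _ h
  | refl a => exact fun _ => rfl
  | symm _ ih => exact fun hn => (ih hn).symm
  | trans _ _ ih₁ ih₂ => exact fun hn => (ih₁ hn).trans (ih₂ hn)
  | @seq_congr n m p a a' b b' _ _ ih₁ ih₂ =>
      intro hn
      -- The intermediate width equals `n`, so the bound also covers the second factor.
      have := a.wires_eq
      simp [ih₁ hn, ih₂ (by omega)]
  | par_congr _ _ ih₁ ih₂ =>
      intro hn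
      simp [ih₁ (by omega), ih₂ (by omega)]
  | seq_assoc a b c => simp [mul_assoc]
  | par_assoc a b c => simp [mul_assoc]
  -- With both compositions sent to one product, interchange forces commutativity of the target.
  | interchange a b c d => simp [mul_mul_mul_comm]
  | par_empty a => simp
  | empty_par a => simp
  | wires_seq a => simp
  | seq_wires a => simp
  | swap_swap => simp [v.w_mul_w]
  | sigma_natural a =>
      obtain rfl := a.wires_eq
      simp [mul_comm]

/-- An axiom is independent of the others if an interpretation refutes one of its instances on at
most `k` wires and validates the instances of the other axioms on at most `k` wires. -/
theorem exists_not_deriv {M : Type} [CommMonoid M] (v : Interp M) (k : ℕ) {i : Axiom}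
    {n m : ℕ} {a b : Circ n m} (hab : QCPrime i a b) (hn : n ≤ k) (hne : v.eval a ≠ v.eval b)
    (hv : ∀ j, j ≠ i → ∀ ⦃n m : ℕ⦄ (a b : Circ n m), QCPrime j a b → n ≤ k →
      v.eval a = v.eval b) :
    ∃ (n m : ℕ) (a b : Circ n m), QCPrime i a b ∧
      ¬ Deriv (fun _ _ c d => ∃ j : Axiom, j ≠ i ∧ QCPrime j c d) a b :=
  ⟨n, m, a, b, hab, fun h => hne <| h.eval_eq v k
    (fun _ _ c d ⟨j, hj, hcd⟩ hk => hv j hj c d hcd hk) hn⟩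

/-! ### Angles of the Euler rule -/

theorem exists_mod2pi_eq (x : ℝ) : ∃ t : ℤ, mod2pi x = x + t * (2 * Real.pi) := by
  refine ⟨-toIcoDiv Real.two_pi_pos 0 x, ?_⟩
  rw [mod2pi, toIcoMod, zsmul_eq_mul]
  push_cast
  ring

theorem mod2pi_eq_self {x : ℝ} (h₀ : 0 ≤ x) (h₁ : x < 2 * Real.pi) : mod2pi x = x := by
  rw [mod2pi, toIcoMod_eq_self]
  exact ⟨h₀, by simpa using h₁⟩

theorem sin_two_mul_mod2pi (x : ℝ) : Real.sin (2 * mod2pi x) = Real.sin (2 * x) := by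
  obtain ⟨t, ht⟩ := exists_mod2pi_eq x
  rw [ht, show 2 * (x + t * (2 * Real.pi)) = 2 * x + (2 * t : ℤ) * (2 * Real.pi) by
    push_cast; ring, Real.sin_add_int_mul_two_pi]

/-- This is (E') on determinants: `RX` has determinant 1, `H` has determinant `-1`, and the scalar
`s β₀` counts twice on one wire. -/
theorem exists_beta_sum (α₁ α₃ : ℝ) : ∃ t : ℤ,
    2 * beta0 α₁ α₃ + beta1 α₁ α₃ + beta3 α₁ α₃ = Real.pi + t * (2 * Real.pi) := by
  unfold beta0 beta1 beta3
  split_ifs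
  · obtain ⟨t, ht⟩ := exists_mod2pi_eq (Real.pi / 2 - (eulerZ α₁ α₃).arg)
    obtain ⟨u, hu⟩ := exists_mod2pi_eq (2 * (eulerZ α₁ α₃).arg)
    exact ⟨2 * t + u, by rw [ht, hu]; push_cast; ring⟩
  · obtain ⟨t, ht⟩ := exists_mod2pi_eq (Real.pi / 2 - (eulerZ' α₁ α₃).arg)
    obtain ⟨u, hu⟩ := exists_mod2pi_eq (2 * (eulerZ' α₁ α₃).arg)
    exact ⟨2 * t + u, by rw [ht, hu]; push_cast; ring⟩
  · obtain ⟨t, ht⟩ := exists_mod2pi_eq (Real.pi / 2 - (eulerZ α₁ α₃).arg)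
    obtain ⟨u, hu⟩ := exists_mod2pi_eq ((eulerZ α₁ α₃).arg + (eulerZ' α₁ α₃).arg)
    obtain ⟨r, hr⟩ := exists_mod2pi_eq ((eulerZ α₁ α₃).arg - (eulerZ' α₁ α₃).arg)
    exact ⟨2 * t + u + r, by rw [ht, hu, hr]; push_cast; ring⟩

/-! ### Axioms on at most two wires -/

theorem s2pi_independent : ∃ (n m : ℕ) (a b : Circ n m), QCPrime .s2pi a b ∧
    ¬ Deriv (fun _ _ c d => ∃ j : Axiom, j ≠ .s2pi ∧ QCPrime j c d) a b := by
  -- On zero wires the only other axiom is (S_+), which any exponential satisfies.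
  refine exists_not_deriv (M := ℝ) ⟨1, fun _ => 1, 1, Real.exp, 1, by simp⟩ 0 .s2pi le_rfl ?_ ?_
  · simp [Real.pi_ne_zero]
  · intro j hj n m a b hab hn
    cases hab <;> simp_all [Real.exp_add]

theorem sAdd_independent : ∃ (n m : ℕ) (a b : Circ n m), QCPrime .sAdd a b ∧
    ¬ Deriv (fun _ _ c d => ∃ j : Axiom, j ≠ .sAdd ∧ QCPrime j c d) a b := by
  refine exists_not_deriv (M := ℝ)
    ⟨1, fun _ => 1, 1, fun φ => if φ = 2 * Real.pi then 1 else 0, 1, by simp⟩ 0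
    (.sAdd Real.pi Real.pi) le_rfl ?_ ?_
  · simp [← two_mul, Real.pi_ne_zero]
  · intro j hj n m a b hab hn
    cases hab <;> simp_all

/-- On one wire, both sides of (E') contain an `H`, so it may be sent to 0. -/
theorem hh_independent : ∃ (n m : ℕ) (a b : Circ n m), QCPrime .hh a b ∧
    ¬ Deriv (fun _ _ c d => ∃ j : Axiom, j ≠ .hh ∧ QCPrime j c d) a b := by
  refine exists_not_deriv (M := ℝ) ⟨0, fun _ => 1, 1, fun _ => 1, 1, by simp⟩ 1 .hh le_rfl ?_ ?_
  · simp
  · intro j hj n m a b hab hn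
    cases hab <;> simp_all [eulerLHS, eulerRHS]

/-- On one wire, both sides of (E') and of (P_+) contain a phase gate. -/
theorem p0_independent : ∃ (n m : ℕ) (a b : Circ n m), QCPrime .p0 a b ∧
    ¬ Deriv (fun _ _ c d => ∃ j : Axiom, j ≠ .p0 ∧ QCPrime j c d) a b := by
  refine exists_not_deriv (M := ℝ) ⟨1, fun _ => 0, 1, fun _ => 1, 1, by simp⟩ 1 .p0 le_rfl ?_ ?_
  · simp
  · intro j hj n m a b hab hn
    cases hab <;> simp_all [eulerLHS, eulerRHS]

/-- The two other axioms on two wires have a `CNOT` on both sides. -/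
theorem cnotPCnot_independent : ∃ (n m : ℕ) (a b : Circ n m), QCPrime .cnotPCnot a b ∧
    ¬ Deriv (fun _ _ c d => ∃ j : Axiom, j ≠ .cnotPCnot ∧ QCPrime j c d) a b := by
  refine exists_not_deriv (M := ℝ) ⟨1, fun _ => 1, 0, fun _ => 1, 1, by simp⟩ 2 (.cnotPCnot 0)
    le_rfl ?_ ?_
  · simp
  · intro j hj n m a b hab hn
    cases hab <;> simp_all [eulerLHS, eulerRHS]

/-- Parity of the number of swaps. -/
theorem bigebre_independent : ∃ (n m : ℕ) (a b : Circ n m), QCPrime .bigebre a b ∧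
    ¬ Deriv (fun _ _ c d => ∃ j : Axiom, j ≠ .bigebre ∧ QCPrime j c d) a b := by
  refine exists_not_deriv (M := ℝ) ⟨1, fun _ => 1, 1, fun _ => 1, -1, by simp⟩ 2 .bigebre
    le_rfl ?_ ?_
  · norm_num
  · intro j hj n m a b hab hn
    cases hab <;> simp_all [eulerLHS, eulerRHS]

/-- Joint parity of `CNOT` and swap gates; (B) has an even total on both sides. -/
theorem cz_independent : ∃ (n m : ℕ) (a b : Circ n m), QCPrime .cz a b ∧
    ¬ Deriv (fun _ _ c d => ∃ j : Axiom, j ≠ .cz ∧ QCPrime j c d) a b := by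
  refine exists_not_deriv (M := ℝ) ⟨1, fun _ => 1, -1, fun _ => 1, -1, by simp⟩ 2 .cz
    le_rfl ?_ ?_
  · norm_num
  · intro j hj n m a b hab hn
    cases hab <;> simp_all [eulerLHS, eulerRHS]

/-! ### Additivity of the phase gate -/

theorem normSq_eulerZ_sub (α₁ α₃ : ℝ) :
    Complex.normSq (eulerZ α₁ α₃) - Complex.normSq (eulerZ' α₁ α₃) =
      2 * (Real.sin α₁ * Real.sin α₃) := by
  have h₁ : α₁ = (α₁ + α₃) / 2 + (α₁ - α₃) / 2 := by ring
  have h₃ : α₃ = (α₁ + α₃) / 2 - (α₁ - α₃) / 2 := by ring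
  set x := (α₁ + α₃) / 2 with hx
  set y := (α₁ - α₃) / 2 with hy
  rw [h₁, h₃, Real.sin_add, Real.sin_sub]
  simp only [Complex.normSq_apply, eulerZ, eulerZ', ← h₁, ← h₃, ← hx, ← hy]
  have := Real.sin_sq_add_cos_sq x
  have := Real.sin_sq_add_cos_sq y
  grind

theorem normSq_eulerZ_add (α₁ α₃ : ℝ) :
    Complex.normSq (eulerZ α₁ α₃) + Complex.normSq (eulerZ' α₁ α₃) = 2 := by
  simp only [Complex.normSq_apply, eulerZ, eulerZ']
  have := Real.sin_sq_add_cos_sq ((α₁ + α₃) / 2)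
  have := Real.sin_sq_add_cos_sq ((α₁ - α₃) / 2)
  grind

theorem eulerZ_mul_eulerZ' (α₁ α₃ : ℝ) :
    eulerZ α₁ α₃ * eulerZ' α₁ α₃ = ⟨-(Real.cos α₁ * Real.sin α₃), Real.cos α₃⟩ := by
  have h₁ : α₁ = (α₁ + α₃) / 2 + (α₁ - α₃) / 2 := by ring
  have h₃ : α₃ = (α₁ + α₃) / 2 - (α₁ - α₃) / 2 := by ring
  set x := (α₁ + α₃) / 2 with hx
  set y := (α₁ - α₃) / 2 with hy
  have := Real.sin_sq_add_cos_sq x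
  have := Real.sin_sq_add_cos_sq y
  rw [h₁, h₃, Real.cos_add, Real.sin_sub, Real.cos_sub]
  apply Complex.ext <;>
    simp only [Complex.mul_re, Complex.mul_im, eulerZ, eulerZ', ← h₁, ← h₃, ← hx, ← hy] <;>
    grind

theorem eulerZ_mul_conj_eulerZ' (α₁ α₃ : ℝ) :
    eulerZ α₁ α₃ * (starRingEnd ℂ) (eulerZ' α₁ α₃) =
      ⟨-(Real.sin α₁ * Real.cos α₃), Real.cos α₁⟩ := by
  have h₁ : α₁ = (α₁ + α₃) / 2 + (α₁ - α₃) / 2 := by ring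
  have h₃ : α₃ = (α₁ + α₃) / 2 - (α₁ - α₃) / 2 := by ring
  set x := (α₁ + α₃) / 2 with hx
  set y := (α₁ - α₃) / 2 with hy
  have := Real.sin_sq_add_cos_sq x
  have := Real.sin_sq_add_cos_sq y
  rw [h₁, h₃, Real.cos_add, Real.sin_add, Real.cos_sub]
  apply Complex.ext <;>
    simp only [Complex.mul_re, Complex.mul_im, Complex.conj_re, Complex.conj_im, eulerZ, eulerZ',
      ← h₁, ← h₃, ← hx, ← hy] <;>
    grind

/-- The double sine of a sum of arguments vanishes exactly when the product is on an axis. -/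
theorem sin_two_mul_arg_add_arg_eq_zero_iff {z w : ℂ} (hz : z ≠ 0) (hw : w ≠ 0) :
    Real.sin (2 * (z.arg + w.arg)) = 0 ↔ (z * w).re * (z * w).im = 0 := by
  have hz' := norm_ne_zero_iff.2 hz
  have hw' := norm_ne_zero_iff.2 hw
  have h₁ : (z * w).re = ‖z‖ * ‖w‖ * Real.cos (z.arg + w.arg) := by
    rw [Complex.mul_re, ← Complex.norm_mul_cos_arg z, ← Complex.norm_mul_cos_arg w,
      ← Complex.norm_mul_sin_arg z, ← Complex.norm_mul_sin_arg w, Real.cos_add]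
    ring
  have h₂ : (z * w).im = ‖z‖ * ‖w‖ * Real.sin (z.arg + w.arg) := by
    rw [Complex.mul_im, ← Complex.norm_mul_cos_arg z, ← Complex.norm_mul_cos_arg w,
      ← Complex.norm_mul_sin_arg z, ← Complex.norm_mul_sin_arg w, Real.sin_add]
    ring
  rw [h₁, h₂, Real.sin_two_mul]
  simp [hz', hw', or_comm]

theorem sin_two_mul_arg_sub_arg_eq_zero_iff {z w : ℂ} (hz : z ≠ 0) (hw : w ≠ 0) :
    Real.sin (2 * (z.arg - w.arg)) = 0 ↔
      (z * (starRingEnd ℂ) w).re * (z * (starRingEnd ℂ) w).im = 0 := by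
  rw [← sin_two_mul_arg_add_arg_eq_zero_iff hz ((map_ne_zero _).2 hw), Complex.arg_conj]
  split_ifs with h
  · rw [h, show 2 * (z.arg + Real.pi) = 2 * (z.arg - Real.pi) + (2 : ℤ) * (2 * Real.pi) by
      push_cast; ring, Real.sin_add_int_mul_two_pi]
  · rw [sub_eq_add_neg]

theorem eulerZ'_eq_zero_or_eulerZ_eq_zero_iff (α₁ α₃ : ℝ) :
    (eulerZ' α₁ α₃ = 0 ∨ eulerZ α₁ α₃ = 0) ↔ Real.cos α₁ = 0 ∧ Real.cos α₃ = 0 := by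
  have hsub := normSq_eulerZ_sub α₁ α₃
  have hadd := normSq_eulerZ_add α₁ α₃
  have h₁ := Real.sin_sq_add_cos_sq α₁
  have h₃ := Real.sin_sq_add_cos_sq α₃
  rw [← Complex.normSq_eq_zero, ← Complex.normSq_eq_zero]
  constructor
  · intro h
    have h' : (Real.sin α₁ * Real.sin α₃) ^ 2 = 1 := by
      -- The squared norms sum to 2, so if one vanishes their difference is `±2`.
      rcases h with h | h <;> grind
    have h₁' := sq_nonneg (Real.cos α₁)
    have h₃' := sq_nonneg (Real.cos α₃)
    have : Real.cos α₁ ^ 2 = 0 := by nlinarith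
    have : Real.cos α₃ ^ 2 = 0 := by nlinarith
    simp_all
  · rintro ⟨hc₁, hc₃⟩
    rw [← mul_eq_zero]
    grind

theorem sin_two_mul_beta_eq_zero_of_degenerate {α₁ α₃ : ℝ}
    (h : eulerZ' α₁ α₃ = 0 ∨ eulerZ α₁ α₃ = 0) :
    Real.sin (2 * beta1 α₁ α₃) = 0 ∧ Real.sin (2 * beta2 α₁ α₃) = 0 ∧
      Real.sin (2 * beta3 α₁ α₃) = 0 := by
  have hx := Real.sin_sq_add_cos_sq ((α₁ + α₃) / 2)
  have hy := Real.sin_sq_add_cos_sq ((α₁ - α₃) / 2)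
  have hadd := normSq_eulerZ_add α₁ α₃
  -- A nonzero number on a diagonal has as argument an odd multiple of `π / 4`.
  have key : ∀ z : ℂ, z ≠ 0 → z.re ^ 2 = z.im ^ 2 → Real.sin (2 * (2 * z.arg)) = 0 := by
    intro z hz h
    rw [two_mul z.arg, sin_two_mul_arg_add_arg_eq_zero_iff hz hz, Complex.mul_re, ← sq, ← sq, h,
      sub_self, zero_mul]
  by_cases hz' : eulerZ' α₁ α₃ = 0
  · have hz : eulerZ α₁ α₃ ≠ 0 := by
      intro hz
      simp [hz, hz'] at hadd
    have hre : Real.cos ((α₁ + α₃) / 2) = 0 := congrArg Complex.re hz'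
    have him : -Real.sin ((α₁ - α₃) / 2) = 0 := congrArg Complex.im hz'
    refine ⟨?_, ?_, ?_⟩
    · rw [beta1, if_pos hz', sin_two_mul_mod2pi]
      refine key _ hz ?_
      simp only [eulerZ]
      grind
    · simp [beta2, hz']
    · simp [beta3, hz']
  · have hz : eulerZ α₁ α₃ = 0 := h.resolve_left hz'
    have hre : -Real.sin ((α₁ + α₃) / 2) = 0 := congrArg Complex.re hz
    have him : Real.cos ((α₁ - α₃) / 2) = 0 := congrArg Complex.im hz
    refine ⟨?_, ?_, ?_⟩
    · rw [beta1, if_neg hz', if_pos hz, sin_two_mul_mod2pi]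
      refine key _ hz' ?_
      simp only [eulerZ']
      grind
    · simp [beta2, hz', hz]
    · simp [beta3, hz', hz]

theorem sin_two_mul_beta2_eq_zero_iff {α₁ α₃ : ℝ} (hz' : eulerZ' α₁ α₃ ≠ 0)
    (hz : eulerZ α₁ α₃ ≠ 0) :
    Real.sin (2 * beta2 α₁ α₃) = 0 ↔ Real.sin α₁ * Real.sin α₃ = 0 := by
  have hr : 0 < ‖eulerZ α₁ α₃ / eulerZ' α₁ α₃‖ := norm_pos_iff.2 (div_ne_zero hz hz')
  have hq : ‖eulerZ α₁ α₃ / eulerZ' α₁ α₃‖ ^ 2 = 1 ↔ Real.sin α₁ * Real.sin α₃ = 0 := by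
    have hsub := normSq_eulerZ_sub α₁ α₃
    have hn : Complex.normSq (eulerZ' α₁ α₃) ≠ 0 := by simpa using hz'
    rw [← Complex.normSq_eq_norm_sq, Complex.normSq_div, div_eq_one_iff_eq hn]
    grind
  -- `(I + r)² = r² - 1 + 2 r I` with `r > 0` lies on an axis only for `r = 1`.
  rw [← hq]
  set r := ‖eulerZ α₁ α₃ / eulerZ' α₁ α₃‖ with hr_def
  have hI : Complex.I + (r : ℂ) ≠ 0 := fun h => by simpa using congrArg Complex.im h
  rw [beta2, if_neg hz', if_neg hz, sin_two_mul_mod2pi, ← hr_def, two_mul (Complex.arg _),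
    sin_two_mul_arg_add_arg_eq_zero_iff hI hI]
  simp only [Complex.mul_re, Complex.mul_im, Complex.add_re, Complex.add_im, Complex.I_re,
    Complex.I_im, Complex.ofReal_re, Complex.ofReal_im]
  grind

/-- In the Euler rule, the angles on the left are all multiples of `π / 2` if and only if those
on the right are. -/
theorem euler_sin_two_mul_eq_zero_iff (α₁ α₃ : ℝ) :
    (Real.sin (2 * α₁) = 0 ∧ Real.sin (2 * α₃) = 0) ↔
      Real.sin (2 * beta1 α₁ α₃) = 0 ∧ Real.sin (2 * beta2 α₁ α₃) = 0 ∧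
        Real.sin (2 * beta3 α₁ α₃) = 0 := by
  by_cases h : eulerZ' α₁ α₃ = 0 ∨ eulerZ α₁ α₃ = 0
  · obtain ⟨h₁, h₃⟩ := (eulerZ'_eq_zero_or_eulerZ_eq_zero_iff α₁ α₃).1 h
    simp [sin_two_mul_beta_eq_zero_of_degenerate h, Real.sin_two_mul, h₁, h₃]
  · have hc := mt (eulerZ'_eq_zero_or_eulerZ_eq_zero_iff α₁ α₃).2 h
    rw [not_or] at h
    obtain ⟨hz', hz⟩ := h
    have h₁ := Real.sin_sq_add_cos_sq α₁
    have h₃ := Real.sin_sq_add_cos_sq α₃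
    rw [sin_two_mul_beta2_eq_zero_iff hz' hz, beta1, beta3, if_neg hz', if_neg hz, if_neg hz',
      if_neg hz, sin_two_mul_mod2pi, sin_two_mul_mod2pi,
      sin_two_mul_arg_add_arg_eq_zero_iff hz hz', sin_two_mul_arg_sub_arg_eq_zero_iff hz hz',
      eulerZ_mul_eulerZ', eulerZ_mul_conj_eulerZ', Real.sin_two_mul, Real.sin_two_mul]
    -- What remains is trigonometric: `hc` says that the two cosines do not both vanish, which
    -- separates the products of sines and cosines.
    grind

-- The angles 1 and -1 are not multiples of `π / 2` but their sum is.
open Classical in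
theorem pAdd_independent : ∃ (n m : ℕ) (a b : Circ n m), QCPrime .pAdd a b ∧
    ¬ Deriv (fun _ _ c d => ∃ j : Axiom, j ≠ .pAdd ∧ QCPrime j c d) a b := by
  refine exists_not_deriv (M := ℝ)
    ⟨1, fun φ => if Real.sin (2 * φ) = 0 then 1 else 0, 1, fun _ => 1, 1, by simp⟩ 1
    (.pAdd 1 (-1)) le_rfl ?_ ?_
  · have : Real.sin (2 * 1) ≠ 0 :=
      (Real.sin_pos_of_pos_of_lt_pi (by norm_num) (by linarith [Real.pi_gt_three])).ne'
    simp_all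
  · intro j hj n m a b hab hn
    cases hab
    case eulerPrime α₁ α₃ =>
      have := euler_sin_two_mul_eq_zero_iff α₁ α₃
      simp only [eulerLHS, eulerRHS, Interp.eval_seq, Interp.eval_par, Interp.eval_RX,
        Interp.eval_H, Interp.eval_s, Interp.eval_P, mul_one, mul_ite, mul_zero]
      grind
    all_goals simp_all

/-! ### Multi-controlled phase gates -/

/-- The determinant of a circuit seen on `K + 3` wires, with halved phase. -/
noncomputable def halfDet (K : ℕ) : Interp ℂ where
  h := 1
  p φ := Complex.exp (φ * (2 ^ (K + 1) * Complex.I))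
  c := (-1) ^ 2 ^ K
  s φ := Complex.exp (φ * (2 ^ (K + 2) * Complex.I))
  w := (-1) ^ 2 ^ K
  w_mul_w := by rw [← mul_pow]; simp

theorem halfDet_mctrlP (K n : ℕ) (φ : ℝ) :
    (halfDet K).eval (mctrlP n φ) = Complex.exp (φ / 2 ^ n * (2 ^ (K + 1) * Complex.I)) := by
  have hc : ((-1 : ℂ) ^ 2 ^ K) * (-1) ^ 2 ^ K = 1 := (halfDet K).w_mul_w
  induction n generalizing φ with
  | zero => simp [mctrlP, halfDet]
  | succ n ih =>
    simp only [mctrlP, Interp.eval_seq, Interp.eval_addWire, Interp.eval_skip, ih,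
      Interp.eval_onLastTwo, Interp.eval_CNOT]
    -- The two `CNOT`s cancel and the three half-angles add up to `φ / 2`.
    rw [mul_right_comm _ (halfDet K).c, mul_assoc _ (halfDet K).c]
    simp only [halfDet, hc, mul_one, ← Complex.exp_add]
    congr 1
    push_cast
    field_simp
    ring

theorem halfDet_mctrlP_of_lt {j K : ℕ} (h : j < K) :
    (halfDet K).eval (mctrlP (j + 2) (2 * Real.pi)) = 1 := by
  obtain ⟨d, rfl⟩ := Nat.exists_eq_add_of_lt h
  rw [halfDet_mctrlP, Complex.exp_eq_one_iff]
  refine ⟨2 ^ d, ?_⟩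
  push_cast
  field_simp
  ring

theorem halfDet_mctrlP_self (K : ℕ) :
    (halfDet K).eval (mctrlP (K + 2) (2 * Real.pi)) = -1 := by
  rw [halfDet_mctrlP, ← Complex.exp_pi_mul_I]
  congr 1
  push_cast
  field_simp
  ring

/-- The determinant itself cannot separate the two sides, which are equal as unitaries. Its square
root is chosen on generators, and the choice is consistent with every axiom on at most `K + 3` wires
except this one; instances of (I) on more wires are excluded by width. -/
theorem ctrl2pi_independent (K : ℕ) : ∃ (n m : ℕ) (a b : Circ n m), QCPrime (.ctrl2pi K) a b ∧
    ¬ Deriv (fun _ _ c d => ∃ j : Axiom, j ≠ .ctrl2pi K ∧ QCPrime j c d) a b := by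
  refine exists_not_deriv (halfDet K) (K + 3) (.ctrl2pi K) le_rfl ?_ ?_
  · rw [halfDet_mctrlP_self, Interp.eval_wires]
    norm_num
  · have hc : (halfDet K).c * (halfDet K).c = 1 := (halfDet K).w_mul_w
    have hh : (halfDet K).h = 1 := rfl
    have hcw : (halfDet K).c = (halfDet K).w := rfl
    have hp : ∀ φ ψ, (halfDet K).p φ * (halfDet K).p ψ = (halfDet K).p (φ + ψ) := by
      intro φ ψ
      simp [halfDet, ← Complex.exp_add, add_mul]
    have hs : ∀ φ ψ, (halfDet K).s φ * (halfDet K).s ψ = (halfDet K).s (φ + ψ) := by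
      intro φ ψ
      simp [halfDet, ← Complex.exp_add, add_mul]
    have hsp : ∀ φ, (halfDet K).s φ = (halfDet K).p (2 * φ) := by
      intro φ
      simp only [halfDet]
      congr 1
      push_cast
      ring
    have hp_zero : (halfDet K).p 0 = 1 := by simp [halfDet]
    have hp_two_pi : ∀ t : ℤ, (halfDet K).p (t * (2 * Real.pi)) = 1 := by
      intro t
      refine Complex.exp_eq_one_iff.2 ⟨t * 2 ^ (K + 1), ?_⟩
      push_cast
      ring
    have hp_pi : (halfDet K).p Real.pi = 1 := by
      refine Complex.exp_eq_one_iff.2 ⟨2 ^ K, ?_⟩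
      push_cast
      ring
    have hp_half : (halfDet K).p (Real.pi / 2) = (halfDet K).c := by
      simp only [halfDet]
      rw [← Complex.exp_pi_mul_I, ← Complex.exp_nat_mul]
      congr 1
      push_cast
      ring
    intro j hj n m a b hab hn
    cases hab with
    | s2pi =>
      have := hp_two_pi 2
      simp_all
    | sAdd φ₁ φ₂ => exact hs φ₁ φ₂
    | hh => simp [hh]
    | p0 => exact hp_zero
    | cnotPCnot φ => simp [mul_right_comm, hc]
    | bigebre => simp [hc, ← hcw]
    | cz =>
      have h₁ : (halfDet K).p (Real.pi / 2) * (halfDet K).p (-Real.pi / 2) = 1 := by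
        rw [hp, ← hp_zero]
        congr 1
        ring
      simp only [Interp.eval_seq, Interp.eval_par, Interp.eval_wire, Interp.eval_H,
        Interp.eval_CNOT, Interp.eval_P, hh, one_mul, mul_one]
      grind
    | pAdd φ₁ φ₂ => exact hp φ₁ φ₂
    | eulerPrime α₁ α₃ =>
      obtain ⟨t, ht⟩ := exists_beta_sum α₁ α₃
      simp only [eulerLHS, eulerRHS, Interp.eval_seq, Interp.eval_par, Interp.eval_RX,
        Interp.eval_H, Interp.eval_s, Interp.eval_P, hh, one_mul, mul_one, hsp, hp]
      rw [show 2 * (-α₁ / 2) + α₁ + (2 * (-α₃ / 2) + α₃) = 0 by ring, hp_zero,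
        show 2 * beta0 α₁ α₃ + (beta1 α₁ α₃ + (2 * (-beta2 α₁ α₃ / 2) + beta2 α₁ α₃) +
          beta3 α₁ α₃) = 2 * beta0 α₁ α₃ + beta1 α₁ α₃ + beta3 α₁ α₃ by ring, ht, ← hp, hp_pi,
        hp_two_pi, one_mul]
    | ctrl2pi j =>
      have : j ≠ K := fun h => hj (h ▸ rfl)
      rw [halfDet_mctrlP_of_lt (by omega), Interp.eval_wires]

/-! ### The Euler rule -/

/-- The difference of the sums of angles of phase gates of both sides of the Euler rule. -/
noncomputable def eulerDefect (x : ℝ × ℝ) : ℝ :=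
  x.1 + x.2 - (beta1 x.1 x.2 + beta2 x.1 x.2 + beta3 x.1 x.2)

/-- For `α₁ = π / 2`, both `z` and `z'` stay on fixed rays, so only `β₂` varies: `β₁ = π / 2`, `β₂ =
π / 2 - a`, `β₃ = π`. The bounds on `a` keep these in `[0, 2π)`, so reduction does nothing. -/
theorem eulerDefect_pi_div_two {a : ℝ} (h₀ : 0 < a) (h₁ : a < 1) :
    eulerDefect (Real.pi / 2, a) = 2 * a - 3 * Real.pi / 2 := by
  have hpi := Real.pi_gt_three
  set x := a / 2 + Real.pi / 4 with hx
  have hs : 0 < Real.sin x := Real.sin_pos_of_pos_of_lt_pi (by linarith) (by linarith)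
  have hc : 0 < Real.cos x := Real.cos_pos_of_mem_Ioo ⟨by linarith, by linarith⟩
  have hx₁ : (Real.pi / 2 + a) / 2 = x := by ring
  have hx₂ : (Real.pi / 2 - a) / 2 = Real.pi / 2 - x := by ring
  have h2 : Real.sqrt 2 * Real.sqrt 2 = 2 := Real.mul_self_sqrt zero_le_two
  have hz : eulerZ (Real.pi / 2) a = Real.sin x * (-1 + Complex.I) := by
    rw [eulerZ, hx₁, hx₂, Real.cos_pi_div_two_sub]
    apply Complex.ext <;> simp [-Complex.ofReal_sin, -Complex.ofReal_cos]
  have hz' : eulerZ' (Real.pi / 2) a = Real.cos x * (1 - Complex.I) := by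
    rw [eulerZ', hx₁, hx₂, Real.sin_pi_div_two_sub]
    apply Complex.ext <;> simp [-Complex.ofReal_sin, -Complex.ofReal_cos]
  have harg : (eulerZ (Real.pi / 2) a).arg = Real.pi - Real.pi / 4 := by
    rw [hz, Complex.arg_real_mul _ hs, show (-1 + Complex.I : ℂ) = (Real.sqrt 2 : ℝ) *
      (Complex.cos (Real.pi - Real.pi / 4 : ℝ) +
        Complex.sin (Real.pi - Real.pi / 4 : ℝ) * Complex.I) by
      rw [← Complex.ofReal_cos, ← Complex.ofReal_sin, Real.cos_pi_sub, Real.sin_pi_sub,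
        Real.cos_pi_div_four, Real.sin_pi_div_four]
      apply Complex.ext <;> simp <;> linarith]
    exact Complex.arg_mul_cos_add_sin_mul_I (by positivity) ⟨by linarith, by linarith⟩
  have harg' : (eulerZ' (Real.pi / 2) a).arg = -(Real.pi / 4) := by
    rw [hz', Complex.arg_real_mul _ hc, show (1 - Complex.I : ℂ) = (Real.sqrt 2 : ℝ) *
      (Complex.cos (-(Real.pi / 4) : ℝ) + Complex.sin (-(Real.pi / 4) : ℝ) * Complex.I) by
      rw [← Complex.ofReal_cos, ← Complex.ofReal_sin, Real.cos_neg, Real.sin_neg,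
        Real.cos_pi_div_four, Real.sin_pi_div_four]
      apply Complex.ext <;> simp <;> linarith]
    exact Complex.arg_mul_cos_add_sin_mul_I (by positivity) ⟨by linarith, by linarith⟩
  have hnz : eulerZ (Real.pi / 2) a ≠ 0 := fun h => by
    rw [h, Complex.arg_zero] at harg
    linarith
  have hnz' : eulerZ' (Real.pi / 2) a ≠ 0 := fun h => by
    rw [h, Complex.arg_zero] at harg'
    linarith
  have hnorm : ‖eulerZ (Real.pi / 2) a / eulerZ' (Real.pi / 2) a‖ =
      (Real.cos x)⁻¹ * Real.sin x := by
    have : ‖(-1 + Complex.I : ℂ)‖ = ‖(1 - Complex.I : ℂ)‖ := by rw [← norm_neg]; congr 1; ring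
    have h0 : ‖(1 - Complex.I : ℂ)‖ ≠ 0 :=
      norm_ne_zero_iff.2 fun h => by simpa using congrArg Complex.im h
    rw [hz, hz', norm_div, norm_mul, norm_mul, this, Complex.norm_of_nonneg hs.le,
      Complex.norm_of_nonneg hc.le]
    field_simp
  have harg₂ : (Complex.I + (((Real.cos x)⁻¹ * Real.sin x : ℝ) : ℂ)).arg = Real.pi / 2 - x := by
    rw [show Complex.I + (((Real.cos x)⁻¹ * Real.sin x : ℝ) : ℂ) = ((Real.cos x)⁻¹ : ℝ) *
      (Complex.cos (Real.pi / 2 - x : ℝ) + Complex.sin (Real.pi / 2 - x : ℝ) * Complex.I) by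
      rw [← Complex.ofReal_cos, ← Complex.ofReal_sin, Real.cos_pi_div_two_sub,
        Real.sin_pi_div_two_sub]
      have hc' : (Real.cos x : ℂ) ≠ 0 := by exact_mod_cast hc.ne'
      push_cast at hc' ⊢
      field_simp
      ring]
    exact Complex.arg_mul_cos_add_sin_mul_I (by positivity) ⟨by linarith, by linarith⟩
  rw [eulerDefect, beta1, beta2, beta3]
  simp only [if_neg hnz, if_neg hnz', harg, harg', hnorm, harg₂]
  rw [mod2pi_eq_self (by linarith) (by linarith), mod2pi_eq_self (by linarith) (by linarith),
    mod2pi_eq_self (by linarith) (by linarith)]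
  ring

theorem not_deriv_euler (T : Set (ℝ × ℝ)) (hT : Cardinal.mk T < Cardinal.continuum) :
    ∃ α₁ α₃ : ℝ, ¬ Deriv (QCPrimeRestrict T) (eulerLHS α₁ α₃) (eulerRHS α₁ α₃) := by
  obtain ⟨V, hTV, hcard⟩ : ∃ V : AddSubgroup ℝ, eulerDefect '' T ⊆ V ∧
      Cardinal.mk V < Cardinal.continuum := by
    -- Only the additive group is used; the generated subfield is a convenient choice with a
    -- cardinality bound.
    refine ⟨(Subfield.closure (eulerDefect '' T)).toSubring.toAddSubgroup,
      Subfield.subset_closure, ?_⟩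
    refine (Subfield.cardinalMk_closure_le_max (eulerDefect '' T)).trans_lt (max_lt ?_ ?_)
    · exact Cardinal.mk_image_le.trans_lt hT
    · exact Cardinal.aleph0_lt_continuum
  obtain ⟨a, h₀, h₁, ha⟩ : ∃ a : ℝ, 0 < a ∧ a < 1 ∧ 2 * a - 3 * Real.pi / 2 ∉ V := by
    by_contra! h
    have hle : Cardinal.mk (Set.Ioo (0 : ℝ) 1) ≤ Cardinal.mk V :=
      Cardinal.mk_le_of_injective
        (f := fun a => (⟨2 * a.1 - 3 * Real.pi / 2, h a.1 a.2.1 a.2.2⟩ : V)) <| by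
        intro a b hab
        have := congrArg Subtype.val hab
        simp only [] at this
        exact Subtype.ext (by linarith)
    rw [Cardinal.mk_Ioo_real one_pos] at hle
    exact hle.not_gt hcard
  -- Sum of the phase-gate angles modulo `V`, everything else being neutral.
  let v : Interp (Multiplicative (ℝ ⧸ V)) :=
    ⟨1, fun φ => Multiplicative.ofAdd (φ : ℝ ⧸ V), 1, fun _ => 1, 1, by simp⟩
  have hv : ∀ α₁ α₃, v.eval (eulerLHS α₁ α₃) = v.eval (eulerRHS α₁ α₃) ↔
      eulerDefect (α₁, α₃) ∈ V := by
    intro α₁ α₃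
    simp only [eulerLHS, eulerRHS, Interp.eval_seq, Interp.eval_par, Interp.eval_RX,
      Interp.eval_H, Interp.eval_s, Interp.eval_P, v, one_mul, mul_one, ← ofAdd_add,
      ← QuotientAddGroup.mk_add]
    rw [Multiplicative.ofAdd.injective.eq_iff, QuotientAddGroup.eq, eulerDefect,
      ← neg_mem_iff]
    congr! 1
    ring
  refine ⟨Real.pi / 2, a, fun h => ?_⟩
  refine ha ?_
  rw [← eulerDefect_pi_div_two h₀ h₁, ← hv]
  refine h.eval_eq v 1 ?_ le_rfl
  rintro n m c d (⟨α₁, α₃, hα⟩ | ⟨l, _, _, hl, hcd⟩) hn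
  · exact (hv α₁ α₃).2 (hTV ⟨_, hα, rfl⟩)
  · cases hcd <;> simp_all [v, ← ofAdd_add]

/-! ### From the restricted theory to the independence of (E'). -/

theorem Deriv.mono {Γ Δ : Theory} (h : ∀ ⦃n m : ℕ⦄ (a b : Circ n m), Γ a b → Δ a b) {n m : ℕ}
    {a b : Circ n m} (hab : Deriv Γ a b) : Deriv Δ a b := by
  induction hab with
  | ax hab => exact .ax (h _ _ hab)
  | refl a => exact .refl a
  | symm _ ih => exact .symm ih
  | trans _ _ ih₁ ih₂ => exact .trans ih₁ ih₂
  | seq_congr _ _ ih₁ ih₂ => exact .seq_congr ih₁ ih₂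
  | par_congr _ _ ih₁ ih₂ => exact .par_congr ih₁ ih₂
  | seq_assoc a b c => exact .seq_assoc a b c
  | par_assoc a b c => exact .par_assoc a b c
  | interchange a b c d => exact .interchange a b c d
  | par_empty a => exact .par_empty a
  | empty_par a => exact .empty_par a
  | wires_seq a => exact .wires_seq a
  | seq_wires a => exact .seq_wires a
  | swap_swap => exact .swap_swap
  | sigma_natural a => exact .sigma_natural a

theorem eulerPrime_independent : ∃ (n m : ℕ) (a b : Circ n m), QCPrime .eulerPrime a b ∧
    ¬ Deriv (fun _ _ c d => ∃ j : Axiom, j ≠ .eulerPrime ∧ QCPrime j c d) a b := by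
  obtain ⟨α₁, α₃, h⟩ := not_deriv_euler ∅ (by simp [Cardinal.continuum_pos])
  exact ⟨1, 1, _, _, .eulerPrime α₁ α₃, fun hd => h (hd.mono
    fun _ _ a b ⟨j, hj, hab⟩ => .other j a b hj hab)⟩

end QCirc

theorem mainTheorem8 :
    QCirc.IsMinimal QCirc.QCPrime ∧
    ∀ T : Set (ℝ × ℝ), Cardinal.mk T < Cardinal.continuum →
      ∃ α₁ α₃ : ℝ,
        ¬ QCirc.Deriv (QCirc.QCPrimeRestrict T)
          (QCirc.eulerLHS α₁ α₃) (QCirc.eulerRHS α₁ α₃) := by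
  refine ⟨fun i => ?_, QCirc.not_deriv_euler⟩
  cases i with
  | s2pi => exact QCirc.s2pi_independent
  | sAdd => exact QCirc.sAdd_independent
  | hh => exact QCirc.hh_independent
  | p0 => exact QCirc.p0_independent
  | cnotPCnot => exact QCirc.cnotPCnot_independent
  | bigebre => exact QCirc.bigebre_independent
  | cz => exact QCirc.cz_independent
  | pAdd => exact QCirc.pAdd_independent
  | eulerPrime => exact QCirc.eulerPrime_independent
  | ctrl2pi k => exact QCirc.ctrl2pi_independent k
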